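/- Let $p \geq 1$, and let $\mathbf{X}$ be a random vector with values in $[0,1]^p$ that admits a density $f$ (with respect to the Lebesgue measure) with $c_1 \leq f(\mathbf{x}) \leq c_2$ for all $\mathbf{x} \in [0,1]^p$, for some constants $c_1, c_2 > 0$. Let $Y = m(\mathbf{X}) + \varepsilon$, where $m : [0,1]^p \to \mathbb{R}$ is square-integrable and $\varepsilon$ is a noise independent of $\mathbf{X}$. For $J \subset \{1, \dots, p\}$ let $\mathbf{X}^{(J)}$ be the subvector of $\mathbf{X}$ with the components in $J$. Let $\{m^{(J)}\}_{J \subset \{1,\dots,p\}}$ be the Hoeffding functional decomposition of $m(\mathbf{X})$, that is, the family of square-integrable functions $m^{(J)}$ on $[0,1]^J$ such that $m(\mathbf{X}) = \sum_{J} m^{(J)}(\mathbf{X}^{(J)})$ almost surely and $\mathbb{E}[m^{(J)}(\mathbf{X}^{(J)}) \mid \mathbf{X}^{(I)}] = 0$ for all $J$ and all $I \subsetneq J$. A tree ensemble is a sum $T = \sum_{\ell=1}^M T_\ell$ with $M \geq 1$, where each $T_\ell$ is the prediction function of a finite binary decision tree whose nodes split according to $x^{(j)} \leq s$ or $x^{(j)}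 > s$ for a variable $j$ and a value $s$, and whose leaves carry real values (any aggregation coefficient being included in the leaf values). For each tree $\ell$ and each variable $j$, the values of all node splits of the tree that involve $x^{(j)}$ cut $[0,1]$ into a partition $\mathcal{A}_\ell^{(j)}$ into intervals; for $J \subset \{1,\dots,p\}$, the Cartesian tree partition $\mathcal{A}_\ell^{(J)}$ of $[0,1]^J$ consists of the products of intervals of the partitions $\mathcal{A}_\ell^{(j)}$, $j \in J$, and $\mathcal{A}_\ell = \mathcal{A}_\ell^{(\{1,\dots,p\})}$. The tree Hoeffding decomposition of $T$ consists of the functions $\eta^{(J)} = \sum_{\ell=1}^M \eta_\ell^{(J)}$, where, for each $\ell$, $\{\eta_\ell^{(J)}\}_J$ is the family of functions such that $\eta_\ell^{(J)}$ is constant on each cell of $\mathcal{A}_\ell^{(J)}$, $T_\ell(\mathbf{X}) = \sum_J \eta_\ell^{(J)}(\mathbf{X}^{(J)})$ almost surely, and $\mathbb{E}[\eta_\ell^{(J)}(\mathbf{X}^{(J)}) \mid \mathbf{X}^{(I)} \in A] = 0$ for all $J$, all $I \subsetneq J$ and all $A \in \mathcal{A}_\ell^{(I)}$ with $\mathbb{P}(\mathbf{X}^{(I)}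 \in A) > 0$. Let $$\Delta_{\mathcal{A}, f} = \sup_{A \in \bigcup_\ell \mathcal{A}_\ell} \ \sup_{\mathbf{x}, \mathbf{x}' \in A} |f(\mathbf{x}) - f(\mathbf{x}')|.$$ Then there exist two constants $K_1, K_2 > 0$ such that, for every tree ensemble $T = \sum_{\ell=1}^M T_\ell$, with tree Hoeffding decomposition $\{\eta^{(J)}\}_J$, and for every $J \subset \{1,\dots,p\}$, $$\mathbb{E}\big[(\eta^{(J)}(\mathbf{X}^{(J)}) - m^{(J)}(\mathbf{X}^{(J)}))^2\big] \leq K_1\, \mathbb{E}\big[(m(\mathbf{X}) - T(\mathbf{X}))^2\big] + K_2\, \Delta_{\mathcal{A}, f}^2 \Big(\sum_{\ell=1}^M \sqrt{\mathbb{E}[T_\ell(\mathbf{X})^2]}\Big)^2.$$ -/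

import Mathlib

open MeasureTheory ProbabilityTheory

noncomputable section

/-- A binary regression tree on `[0,1]^p`: a leaf carries the predicted value, and a node
`node j s l r` sends `x` to `l` if `x j ≤ s` and to `r` otherwise. -/
inductive RegTree (p : ℕ) : Type
  | leaf (c : ℝ) : RegTree p
  | node (j : Fin p) (s : ℝ) (l r : RegTree p) : RegTree p

namespace RegTree

variable {p : ℕ}

/-- The prediction function of a tree. An aggregation coefficient (learning rate, `1/M`, ...)
is part of the leaf values. -/
def predict : RegTree p → (Fin p → unitInterval) → ℝ
  | leaf c, _ => c
  | node j s l r, x => if (x j : ℝ) ≤ s then l.predict x else r.predict x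

/-- The values of the splits involving the variable `j`, collected over all nodes of the tree. -/
def splits : RegTree p → Fin p → Finset ℝ
  | leaf _, _ => ∅
  | node k s l r, j => (if k = j then {s} else ∅) ∪ (l.splits j ∪ r.splits j)

/-- The partition of `[0,1]` into the intervals cut out by the split values of the variable `j`:
the interval of `u` consists of the points that lie on the same side as `u` of every split. -/
def intervals (t : RegTree p) (j : Fin p) : Set (Set unitInterval) :=
  {B | ∃ u : unitInterval,
    B = {v : unitInterval | ∀ s ∈ t.splits j, ((v : ℝ) ≤ s ↔ (u : ℝ) ≤ s)}}

/-- The Cartesian tree partition of `[0,1]^J`: the products over `j ∈ J` of intervals of the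
one-dimensional partitions. -/
def cartesianPartition (t : RegTree p) (J : Finset (Fin p)) : Set (Set (J → unitInterval)) :=
  {A | ∃ B : J → Set unitInterval, (∀ j : J, B j ∈ t.intervals j) ∧ A = Set.univ.pi B}

end RegTree

/-- The prediction function of a tree ensemble, the sum of the predictions of its trees. -/
def ensemblePredict {p M : ℕ} (T : Fin M → RegTree p) (x : Fin p → unitInterval) : ℝ :=
  ∑ l, (T l).predict x

/-- The maximum variability of `f` within the cells of the Cartesian tree partitions of
`[0,1]^p` associated with the trees of an ensemble. -/
def cellVariability {p M : ℕ} (T : Fin M → RegTree p) (f : (Fin p → unitInterval) → ℝ) : ℝ :=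
  sSup {d | ∃ l, ∃ A ∈ (T l).cartesianPartition Finset.univ, ∃ x x' : Fin p → unitInterval,
    Finset.univ.restrict x ∈ A ∧ Finset.univ.restrict x' ∈ A ∧ d = |f x - f x'|}

/-- `f` is a density of the random vector `X` with values in `[0,1]^p`, with respect to the
Lebesgue measure. -/
structure HasCubeDensity {Ω : Type*} [MeasurableSpace Ω] (P : Measure Ω) {p : ℕ}
    (X : Ω → Fin p → unitInterval) (f : (Fin p → unitInterval) → ℝ) : Prop where
  measurable_vector : Measurable X
  measurable_density : Measurable f
  law_eq : P.map X = volume.withDensity (fun x => ENNReal.ofReal (f x))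

/-- The family `νJ` is the Hoeffding functional decomposition of `ν(X)`: the components are
square-integrable with respect to the law of the subvector `X^(J)`, they satisfy
`E[ν^(J)(X^(J)) | X^(I)] = 0` for every strict subset `I` of `J`, and they sum to `ν(X)`. -/
structure IsHoeffdingDecomposition {Ω : Type*} [MeasurableSpace Ω] (P : Measure Ω) {p : ℕ}
    (X : Ω → Fin p → unitInterval) (ν : (Fin p → unitInterval) → ℝ)
    (νJ : (J : Finset (Fin p)) → (J → unitInterval) → ℝ) : Prop where
  memLp : ∀ J : Finset (Fin p), MemLp (νJ J) 2 (P.map (fun ω => J.restrict (X ω)))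
  condExp_eq_zero : ∀ I J : Finset (Fin p), I ⊂ J →
    P[fun ω => νJ J (J.restrict (X ω)) |
      MeasurableSpace.comap (fun ω => I.restrict (X ω)) inferInstance] =ᵐ[P] 0
  sum_eq : ∀ᵐ ω ∂P, ν (X ω) = ∑ J : Finset (Fin p), νJ J (J.restrict (X ω))

/-- The family `η` is the tree Hoeffding decomposition of a single tree `t`: the component
`η^(J)` is constant on each cell of the Cartesian tree partition of `[0,1]^J`,
`E[η^(J)(X^(J)) | X^(I) ∈ A] = 0` for every strict subset `I` of `J` and every cell `A` of
`[0,1]^I`, and the components sum to the prediction of the tree. -/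
structure IsTreeHoeffdingDecomposition {Ω : Type*} [MeasurableSpace Ω] (P : Measure Ω) {p : ℕ}
    (X : Ω → Fin p → unitInterval) (t : RegTree p)
    (η : (J : Finset (Fin p)) → (J → unitInterval) → ℝ) : Prop where
  piecewise_constant : ∀ J : Finset (Fin p), ∀ A ∈ t.cartesianPartition J,
    ∃ c : ℝ, ∀ x ∈ A, η J x = c
  cond_integral_eq_zero : ∀ I J : Finset (Fin p), I ⊂ J → ∀ A ∈ t.cartesianPartition I,
    ∫ ω, η J (J.restrict (X ω)) ∂(P[|{ω | I.restrict (X ω) ∈ A}]) = 0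
  sum_eq : ∀ᵐ ω ∂P, t.predict (X ω) = ∑ J : Finset (Fin p), η J (J.restrict (X ω))

end

/-! Put `g K = ∑ l, η l K - mJ K`, viewed on the cube. The sum of the `g K` is `T - m`, so the claim
is a stability estimate: each component of a sum must be controlled by the sum.

For components that are exactly or nearly hierarchically orthogonal under the density `f`, this is
`exists_lpNorm_le_of_hierarchically_orthogonal`. The alternating sum `anovaComponent K` of Lebesgue
averages kills every function of coordinates not containing `K`. Hence on `g K` it takes the same
value as on the full sum minus the components of strict supersets of `K`. Conversely, pairing `g K`
with its own ANOVA component under `f` returns `∫ (g K)² f` up to sign and up to the pairings with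
averages over fewer coordinates, which are small. A downward induction on `K` concludes.

The component `mJ K` is exactly orthogonal to functions of fewer coordinates. A tree component only
has mean zero on cells, but it is constant on cells, so its pairing with any function of fewer
coordinates is of order Δ, the oscillation of `f` on cells
(`IsCellConstant.abs_integral_mul_mul_le`). The resulting error involves the norms of the tree
components. These are bounded by the same stability estimate, now without error: averages of
cell-constant functions are cell-constant, so a tree component is exactly orthogonal to its own
averages. -/

/-! ### L² norms and Cauchy–Schwarz with a bounded weight. -/

section LpNorm

variable {α : Type*} [MeasurableSpace α] {μ : Measure α} {u v : α → ℝ}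

lemma lpNorm_two_sq (hu : AEStronglyMeasurable u μ) :
    lpNorm u 2 μ ^ 2 = ∫ x, u x ^ 2 ∂μ := by
  have h0 : 0 ≤ ∫ x, u x ^ 2 ∂μ := integral_nonneg fun x => sq_nonneg _
  rw [lpNorm_eq_integral_norm_rpow_toReal (by norm_num) (by norm_num) hu]
  simp only [ENNReal.toReal_ofNat, Real.rpow_ofNat, Real.norm_eq_abs, sq_abs]
  rw [← Real.rpow_natCast, ← Real.rpow_mul h0]
  norm_num

lemma lpNorm_congr_ae {p : ENNReal} (h : u =ᵐ[μ] v) : lpNorm u p μ = lpNorm v p μ := by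
  by_cases hu : AEStronglyMeasurable u μ
  · rw [← toReal_eLpNorm hu, ← toReal_eLpNorm (hu.congr h), eLpNorm_congr_ae h]
  · rw [lpNorm_of_not_aestronglyMeasurable hu,
      lpNorm_of_not_aestronglyMeasurable fun hv => hu (hv.congr h.symm)]

lemma integral_abs_mul_abs_le_lpNorm_mul_lpNorm (hu : MemLp u 2 μ) (hv : MemLp v 2 μ) :
    ∫ x, |u x| * |v x| ∂μ ≤ lpNorm u 2 μ * lpNorm v 2 μ := by
  have := integral_mul_norm_le_Lp_mul_Lq (μ := μ) (f := u) (g := v) Real.HolderConjugate.two_two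
    (by simpa using hu) (by simpa using hv)
  rw [lpNorm_eq_integral_norm_rpow_toReal (by norm_num) (by norm_num) hu.1,
    lpNorm_eq_integral_norm_rpow_toReal (by norm_num) (by norm_num) hv.1]
  simpa using this

lemma abs_integral_mul_mul_le {w : α → ℝ} {c : ℝ} (hc : 0 ≤ c)
    (hw : ∀ᵐ x ∂μ, |w x| ≤ c) (hu : MemLp u 2 μ) (hv : MemLp v 2 μ) :
    |∫ x, u x * v x * w x ∂μ| ≤ c * (lpNorm u 2 μ * lpNorm v 2 μ) := by
  have hi : Integrable (fun x => c * (|u x| * |v x|)) μ :=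
    (hu.abs.integrable_mul hv.abs).const_mul c
  calc |∫ x, u x * v x * w x ∂μ| ≤ ∫ x, c * (|u x| * |v x|) ∂μ := by
        rw [← Real.norm_eq_abs]
        refine norm_integral_le_of_norm_le hi ?_
        filter_upwards [hw] with x hx
        rw [Real.norm_eq_abs, abs_mul, abs_mul, mul_comm]
        gcongr
    _ ≤ _ := by
        rw [integral_const_mul]
        gcongr
        exact integral_abs_mul_abs_le_lpNorm_mul_lpNorm hu hv

end LpNorm

lemma measurable_finset_piecewise {ι α : Type*} [DecidableEq ι] [MeasurableSpace α]
    (I : Finset ι) : Measurable fun z : (ι → α) × (ι → α) => I.piecewise z.1 z.2 := by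
  refine measurable_pi_lambda _ fun i => ?_
  by_cases hi : i ∈ I
  · simp only [hi, Finset.piecewise_eq_of_mem]
    fun_prop
  · simp only [hi, not_false_eq_true, Finset.piecewise_eq_of_notMem]
    fun_prop

/-! ### Averaging over coordinates under a product probability measure. -/

section CoordAverage

variable {ι : Type*} [Fintype ι] [DecidableEq ι] {α : Type*} [MeasureSpace α]

/-- The average of `g` over the coordinates outside `I`. -/
noncomputable def coordAverage (I : Finset ι) (g : (ι → α) → ℝ) (x : ι → α) : ℝ :=
  ∫ y : ι → α, g (I.piecewise x y)

variable {I J : Finset ι} {g u v : (ι → α) → ℝ}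

lemma dependsOn_coordAverage (I : Finset ι) (g : (ι → α) → ℝ) :
    DependsOn (coordAverage I g) (I : Set ι) := by
  intro x x' h
  unfold coordAverage
  congr 1
  ext y
  congr 1
  exact I.piecewise_congr (fun i hi => h i hi) fun _ _ => rfl

lemma coordAverage_congr_of_dependsOn {K : Finset ι} (hg : DependsOn g (K : Set ι))
    (h : K ∩ I = K ∩ J) : coordAverage I g = coordAverage J g := by
  ext x
  unfold coordAverage
  congr 1
  ext y
  refine hg fun i hi => ?_
  have := congrArg (i ∈ ·) h
  simp only [Finset.mem_inter, Finset.mem_coe.1 hi, true_and, eq_iff_iff] at this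
  by_cases hI : i ∈ I <;> simp [hI, ← this]

section Probability

variable [IsProbabilityMeasure (volume : Measure α)]

lemma coordAverage_eq_self_of_dependsOn {K : Finset ι} (hg : DependsOn g (K : Set ι))
    (h : K ⊆ I) : coordAverage I g = g := by
  ext x
  have : ∀ y, g (I.piecewise x y) = g x := fun y => hg fun i hi => by simp [h hi]
  simp [coordAverage, this]

/-- Splicing two independent points coordinatewise gives a point with the same product law; on boxes
the two families of factors multiply back together. Fubini for `coordAverage` rests on this. -/
lemma measurePreserving_finset_piecewise (I : Finset ι) :
    MeasurePreserving (fun z : (ι → α) × (ι → α) => I.piecewise z.1 z.2)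
      (volume.prod volume) volume := by
  refine ⟨measurable_finset_piecewise I, ?_⟩
  rw [volume_pi]
  symm
  refine Measure.pi_eq fun s hs => ?_
  rw [Measure.map_apply (measurable_finset_piecewise I) (MeasurableSet.univ_pi hs)]
  have : (fun z : (ι → α) × (ι → α) => I.piecewise z.1 z.2) ⁻¹' Set.univ.pi s
      = (Set.univ.pi fun i => if i ∈ I then s i else Set.univ) ×ˢ
        (Set.univ.pi fun i => if i ∈ I then Set.univ else s i) := by
    ext z
    simp only [Set.mem_preimage, Set.mem_prod, Set.mem_univ_pi, ← forall_and]
    refine forall_congr' fun i => ?_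
    by_cases hi : i ∈ I <;> simp [hi]
  rw [this, Measure.prod_prod, Measure.pi_pi, Measure.pi_pi, ← Finset.prod_mul_distrib]
  refine Finset.prod_congr rfl fun i _ => ?_
  by_cases hi : i ∈ I <;> simp [hi]

lemma measurable_coordAverage (hg : Measurable g) (I : Finset ι) :
    Measurable (coordAverage I g) :=
  (StronglyMeasurable.integral_prod_right
    (f := fun x y : ι → α => g (I.piecewise x y))
    (hg.comp (measurable_finset_piecewise I)).stronglyMeasurable).measurable

lemma integrable_comp_finset_piecewise (hg : Integrable g) (I : Finset ι) :
    Integrable (fun z : (ι → α) × (ι → α) => g (I.piecewise z.1 z.2)) (volume.prod volume) :=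
  (measurePreserving_finset_piecewise I).integrable_comp_of_integrable hg

lemma integral_coordAverage (hg : Integrable g) (I : Finset ι) :
    ∫ x, coordAverage I g x = ∫ x, g x := by
  unfold coordAverage
  rw [← integral_prod _ (integrable_comp_finset_piecewise hg I)]
  have h := measurePreserving_finset_piecewise (α := α) I
  conv_rhs => rw [← h.map_eq]
  rw [integral_map h.measurable.aemeasurable (by rw [h.map_eq]; exact hg.1)]

/-- The pull-out property of conditional expectation: `v` is not affected by the averaging, so it
leaves the inner integral. -/
lemma integral_mul_coordAverage (hv : DependsOn v (I : Set ι))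
    (huv : Integrable fun x => u x * v x) :
    ∫ x, u x * v x = ∫ x, coordAverage I u x * v x := by
  rw [← integral_coordAverage huv I]
  congr 1
  ext x
  unfold coordAverage
  rw [← integral_mul_const]
  congr 1
  ext y
  exact congrArg (u (I.piecewise x y) * ·) (hv fun i hi => by simp [Finset.mem_coe.1 hi])

lemma integrable_coordAverage (hg : Integrable g) (I : Finset ι) :
    Integrable (coordAverage I g) :=
  (integrable_comp_finset_piecewise hg I).integral_prod_left

lemma sq_coordAverage_le (hg2 : MemLp g 2) (I : Finset ι) :
    ∀ᵐ x, coordAverage I g x ^ 2 ≤ coordAverage I (fun z => g z ^ 2) x := by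
  filter_upwards [(integrable_comp_finset_piecewise hg2.integrable_sq I).prod_right_ae,
    (integrable_comp_finset_piecewise (hg2.integrable one_le_two) I).prod_right_ae] with x hx hx1
  exact ConvexOn.map_integral_le (g := fun t : ℝ => t ^ 2) (s := Set.univ)
    (Even.convexOn_pow (by decide)) (by fun_prop) isClosed_univ (by simp) hx1 hx

lemma memLp_coordAverage (hg : Measurable g) (hg2 : MemLp g 2) (I : Finset ι) :
    MemLp (coordAverage I g) 2 := by
  have hm := measurable_coordAverage hg I
  rw [memLp_two_iff_integrable_sq hm.aestronglyMeasurable]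
  refine (integrable_coordAverage hg2.integrable_sq I).mono'
    (hm.pow_const 2).aestronglyMeasurable ?_
  filter_upwards [sq_coordAverage_le hg2 I] with x hx
  rwa [Real.norm_eq_abs, abs_of_nonneg (sq_nonneg _)]

lemma lpNorm_coordAverage_le (hg : Measurable g) (hg2 : MemLp g 2) (I : Finset ι) :
    lpNorm (coordAverage I g) 2 volume ≤ lpNorm g 2 volume := by
  refine (sq_le_sq₀ lpNorm_nonneg lpNorm_nonneg).1 ?_
  rw [lpNorm_two_sq (measurable_coordAverage hg I).aestronglyMeasurable,
    lpNorm_two_sq hg2.1, ← integral_coordAverage hg2.integrable_sq I]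
  exact integral_mono_ae (memLp_coordAverage hg hg2 I).integrable_sq
    (integrable_coordAverage hg2.integrable_sq I) (sq_coordAverage_le hg2 I)

/-- Additivity holds only almost everywhere: on a null set of `x` a section may fail to be
integrable, and its integral is then 0 by convention. -/
lemma coordAverage_sum_ae {κ : Type*} (s : Finset κ) (h : κ → (ι → α) → ℝ)
    (hh : ∀ k ∈ s, Integrable (h k)) (I : Finset ι) :
    coordAverage I (∑ k ∈ s, h k) =ᵐ[volume] ∑ k ∈ s, coordAverage I (h k) := by
  have : ∀ᵐ x : ι → α, ∀ k ∈ s, Integrable fun y => h k (I.piecewise x y) := by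
    rw [Filter.eventually_all_finset]
    exact fun k hk => (integrable_comp_finset_piecewise (hh k hk) I).prod_right_ae
  filter_upwards [this] with x hx
  simp only [coordAverage, Finset.sum_apply]
  exact integral_finsetSum _ hx

end Probability

end CoordAverage

/-! ### Stability of nearly orthogonal decompositions. -/

section Stability

variable {ι : Type*} [Fintype ι] [DecidableEq ι] {α : Type*} [MeasureSpace α]

/-- Up to sign, the component on the coordinates in `K` of the functional ANOVA decomposition of
`h` for the product measure. -/
noncomputable def anovaComponent (K : Finset ι) (h : (ι → α) → ℝ) : (ι → α) → ℝ :=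
  ∑ I ∈ K.powerset, (-1 : ℝ) ^ I.card • coordAverage I h

variable {K J : Finset ι} {h : (ι → α) → ℝ}

/-- Choose `j ∈ K \ J` and pair `I` with `insert j I`: the averages agree because `h` ignores `j`,
and the signs are opposite. -/
lemma anovaComponent_eq_zero (hh : DependsOn h (J : Set ι)) (hKJ : ¬ K ⊆ J) :
    anovaComponent K h = 0 := by
  obtain ⟨j, hjK, hjJ⟩ := Finset.not_subset.1 hKJ
  unfold anovaComponent
  rw [← Finset.insert_erase hjK, Finset.sum_powerset_insert (Finset.notMem_erase j K),
    ← Finset.sum_add_distrib]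
  refine Finset.sum_eq_zero fun I hI => ?_
  have hjI : j ∉ I := fun hj => Finset.notMem_erase j K (Finset.mem_powerset.1 hI hj)
  have : J ∩ insert j I = J ∩ I := by
    ext i
    simp only [Finset.mem_inter, Finset.mem_insert]
    constructor
    · rintro ⟨hi, rfl | hi'⟩
      · exact absurd hi hjJ
      · exact ⟨hi, hi'⟩
    · exact fun hi => ⟨hi.1, Or.inr hi.2⟩
  rw [coordAverage_congr_of_dependsOn hh this, Finset.card_insert_of_notMem hjI, pow_succ]
  simp

variable [IsProbabilityMeasure (volume : Measure α)]

lemma anovaComponent_sum_ae {κ : Type*} (s : Finset κ) (g : κ → (ι → α) → ℝ)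
    (hg : ∀ k ∈ s, Integrable (g k)) (K : Finset ι) :
    anovaComponent K (∑ k ∈ s, g k) =ᵐ[volume] ∑ k ∈ s, anovaComponent K (g k) := by
  have : ∀ᵐ x : ι → α, ∀ I ∈ K.powerset, coordAverage I (∑ k ∈ s, g k) x
      = (∑ k ∈ s, coordAverage I (g k)) x := by
    rw [Filter.eventually_all_finset]
    exact fun I _ => coordAverage_sum_ae s g hg I
  filter_upwards [this] with x hx
  simp only [anovaComponent, Finset.sum_apply, Pi.smul_apply] at hx ⊢
  rw [Finset.sum_comm, Finset.sum_congr rfl fun I hI => by rw [hx I hI, Finset.smul_sum]]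

lemma lpNorm_anovaComponent_le (hh : Measurable h) (hh2 : MemLp h 2) (K : Finset ι) :
    lpNorm (anovaComponent K h) 2 volume
      ≤ Fintype.card (Finset ι) * lpNorm h 2 volume := by
  unfold anovaComponent
  refine (lpNorm_sum_le (fun I _ => (memLp_coordAverage hh hh2 I).const_smul _)
    one_le_two).trans ?_
  calc _ ≤ ∑ I ∈ K.powerset, lpNorm h 2 volume := by
        refine Finset.sum_le_sum fun I _ => ?_
        rw [lpNorm_const_smul]
        simpa using lpNorm_coordAverage_le hh hh2 I
    _ ≤ ∑ I : Finset ι, lpNorm h 2 volume :=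
        Finset.sum_le_sum_of_subset_of_nonneg (Finset.subset_univ _) fun _ _ _ => lpNorm_nonneg
    _ = _ := by simp

lemma memLp_anovaComponent (hh : Measurable h) (hh2 : MemLp h 2) (K : Finset ι) :
    MemLp (anovaComponent K h) 2 :=
  memLp_finsetSum' _ fun I _ => (memLp_coordAverage hh hh2 I).const_smul _

lemma anovaComponent_eq_self_add (hh : DependsOn h (K : Set ι)) :
    anovaComponent K h
      = (-1 : ℝ) ^ K.card • h + ∑ I ∈ K.ssubsets, (-1 : ℝ) ^ I.card • coordAverage I h := by
  unfold anovaComponent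
  rw [Finset.ssubsets, ← Finset.add_sum_erase _ _ (Finset.mem_powerset_self K),
    coordAverage_eq_self_of_dependsOn hh subset_rfl]

variable {f : (ι → α) → ℝ} {c₁ c₂ : ℝ}

/-- A function of the coordinates in `K` that is nearly orthogonal to its averages over fewer
coordinates is controlled by its ANOVA component on `K`. -/
lemma lpNorm_le_lpNorm_anovaComponent (hf : Measurable f) (hc₁ : 0 < c₁) (hc₂ : 0 < c₂)
    (hfc : ∀ x, c₁ ≤ f x ∧ f x ≤ c₂) {u : (ι → α) → ℝ} (hu : Measurable u) (hu2 : MemLp u 2)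
    (huK : DependsOn u (K : Set ι)) {e : ℝ} (he : 0 ≤ e)
    (horth : ∀ I, I ⊂ K →
      |∫ x, u x * coordAverage I u x * f x| ≤ e * lpNorm u 2 volume) :
    c₁ * lpNorm u 2 volume
      ≤ c₂ * lpNorm (anovaComponent K u) 2 volume + Fintype.card (Finset ι) * e := by
  have hfb : ∀ᵐ x : ι → α, |f x| ≤ c₂ :=
    ae_of_all _ fun x => abs_le.2 ⟨by linarith [(hfc x).1], (hfc x).2⟩
  have hmul : ∀ v : (ι → α) → ℝ, MemLp v 2 → Integrable fun x => u x * v x * f x := fun v hv =>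
    (hu2.integrable_mul hv).mul_bdd (c := c₂) hf.aestronglyMeasurable hfb
  set n := lpNorm u 2 volume with hn
  have hn0 : 0 ≤ n := lpNorm_nonneg
  have hlow : c₁ * n ^ 2 ≤ ∫ x, u x * u x * f x := by
    rw [hn, lpNorm_two_sq hu2.1, ← integral_const_mul]
    refine integral_mono (hu2.integrable_sq.const_mul _) (hmul u hu2) fun x => ?_
    nlinarith [mul_nonneg (sq_nonneg (u x)) (sub_nonneg.2 (hfc x).1)]
  have hcomp := abs_integral_mul_mul_le hc₂.le hfb hu2 (memLp_anovaComponent hu hu2 K)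
  have hsplit : ∫ x, u x * anovaComponent K u x * f x
      = (-1) ^ K.card * (∫ x, u x * u x * f x)
        + ∑ I ∈ K.ssubsets, (-1) ^ I.card * ∫ x, u x * coordAverage I u x * f x := by
    have hI := fun I => hmul _ (memLp_coordAverage hu hu2 I)
    simp_rw [← integral_const_mul]
    rw [← integral_finsetSum _ fun I _ => (hI I).const_mul _,
      ← integral_add ((hmul u hu2).const_mul _)
        (integrable_finsetSum _ fun I _ => (hI I).const_mul _),
      anovaComponent_eq_self_add huK]
    congr 1
    ext x
    simp only [Pi.add_apply, Pi.smul_apply, Finset.sum_apply, smul_eq_mul, mul_add, add_mul,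
      Finset.mul_sum, Finset.sum_mul]
    congr 1
    · ring
    · exact Finset.sum_congr rfl fun I _ => by ring
  have hrest : |∑ I ∈ K.ssubsets, (-1) ^ I.card * ∫ x, u x * coordAverage I u x * f x|
      ≤ Fintype.card (Finset ι) * (e * n) := by
    refine (Finset.abs_sum_le_sum_abs _ _).trans ?_
    calc _ ≤ ∑ I ∈ K.ssubsets, e * n := by
          refine Finset.sum_le_sum fun I hI => ?_
          rw [abs_mul, abs_pow, abs_neg, abs_one, one_pow, one_mul]
          exact horth I (Finset.mem_ssubsets.1 hI)
      _ ≤ ∑ I : Finset ι, e * n :=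
          Finset.sum_le_sum_of_subset_of_nonneg (Finset.subset_univ _)
            fun _ _ _ => mul_nonneg he hn0
      _ = _ := by simp
  have hmain : (∫ x, u x * u x * f x) ≤ c₂ * (n * lpNorm (anovaComponent K u) 2 volume)
      + Fintype.card (Finset ι) * (e * n) := by
    calc ∫ x, u x * u x * f x ≤ |(-1) ^ K.card * ∫ x, u x * u x * f x| := by
          rw [abs_mul, abs_pow, abs_neg, abs_one, one_pow, one_mul]
          exact le_abs_self _
      _ ≤ _ := by
          rw [← sub_eq_of_eq_add hsplit]
          exact (abs_sub _ _).trans (add_le_add hcomp hrest)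
  -- `hlow` and `hmain` give the claim multiplied by `n`, so it remains to divide unless `n = 0`.
  rcases hn0.eq_or_lt with h0 | h0
  · rw [← h0, mul_zero]
    have : 0 ≤ lpNorm (anovaComponent K u) 2 volume := lpNorm_nonneg
    positivity
  · refine le_of_mul_le_mul_right ?_ h0
    linarith

/-- The inductive step: the norms of strict supersets of `K` stay on the right-hand side, since
their components are the only ones besides `g K` that survive `anovaComponent K`. -/
lemma lpNorm_le_of_hierarchically_orthogonal_aux (hf : Measurable f) (hc₁ : 0 < c₁)
    (hc₂ : 0 < c₂) (hfc : ∀ x, c₁ ≤ f x ∧ f x ≤ c₂) {g : Finset ι → (ι → α) → ℝ}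
    (hg : ∀ J, Measurable (g J)) (hg2 : ∀ J, MemLp (g J) 2)
    (hgJ : ∀ J, DependsOn (g J) (J : Set ι)) {e : ℝ} (he : 0 ≤ e)
    (horth : ∀ I K, I ⊂ K →
      |∫ x, g K x * coordAverage I (g K) x * f x| ≤ e * lpNorm (g K) 2 volume)
    (K : Finset ι) :
    c₁ * lpNorm (g K) 2 volume
      ≤ Fintype.card (Finset ι) * (c₂ * (lpNorm (∑ J, g J) 2 volume
        + ∑ J with K ⊂ J, lpNorm (g J) 2 volume) + e) := by
  have hmain := lpNorm_le_lpNorm_anovaComponent hf hc₁ hc₂ hfc (hg K) (hg2 K) (hgJ K) he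
    fun I hI => horth I K hI
  set h' : (ι → α) → ℝ := ∑ J with ¬ K ⊂ J, g J with hh'
  have hh'm : Measurable h' := by
    rw [hh']
    fun_prop
  have hh'2 : MemLp h' 2 := memLp_finsetSum' _ fun J _ => hg2 J
  have hcomp : lpNorm (anovaComponent K (g K)) 2 volume = lpNorm (anovaComponent K h') 2 volume := by
    refine lpNorm_congr_ae ?_
    have := anovaComponent_sum_ae (Finset.univ.filter fun J => ¬ K ⊂ J) g
      (fun J _ => (hg2 J).integrable one_le_two) K
    refine Filter.EventuallyEq.trans ?_ this.symm
    rw [Finset.sum_eq_single_of_mem K (by simp)]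
    intro J hJ hJK
    refine anovaComponent_eq_zero (hgJ J) fun hsub => ?_
    exact (Finset.mem_filter.1 hJ).2 (hsub.ssubset_of_ne hJK.symm)
  have hle : lpNorm h' 2 volume
      ≤ lpNorm (∑ J, g J) 2 volume + ∑ J with K ⊂ J, lpNorm (g J) 2 volume := by
    have : h' = ∑ J, g J - ∑ J with K ⊂ J, g J := by
      rw [← Finset.sum_filter_add_sum_filter_not _ (fun J => K ⊂ J), add_sub_cancel_left]
    rw [this]
    have hall : MemLp (∑ J, g J) 2 := memLp_finsetSum' _ fun J _ => hg2 J
    exact (lpNorm_sub_le hall one_le_two).trans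
      (add_le_add_right (lpNorm_sum_le (fun J _ => hg2 J) one_le_two) _)
  have h1 := lpNorm_anovaComponent_le hh'm hh'2 K
  have h2 := h1.trans (mul_le_mul_of_nonneg_left hle (Nat.cast_nonneg _))
  rw [hcomp] at hmain
  nlinarith [mul_le_mul_of_nonneg_left h2 hc₂.le]

/-- Stability of hierarchically orthogonal decompositions: the components of a sum of functions of
subvectors that are nearly hierarchically orthogonal, for a density bounded from above and from
below, are controlled by the sum. -/
theorem exists_lpNorm_le_of_hierarchically_orthogonal (hf : Measurable f) (hc₁ : 0 < c₁)
    (hc₂ : 0 < c₂) (hfc : ∀ x, c₁ ≤ f x ∧ f x ≤ c₂) :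
    ∃ C : ℝ, 0 < C ∧ ∀ (g : Finset ι → (ι → α) → ℝ) (e : ℝ), (∀ J, Measurable (g J)) →
      (∀ J, MemLp (g J) 2) → (∀ J, DependsOn (g J) (J : Set ι)) → 0 ≤ e →
      (∀ I K, I ⊂ K →
        |∫ x, g K x * coordAverage I (g K) x * f x| ≤ e * lpNorm (g K) 2 volume) →
      ∀ K, lpNorm (g K) 2 volume ≤ C * (lpNorm (∑ J, g J) 2 volume + e) := by
  have key : ∀ K : Finset ι, ∃ C : ℝ, 0 ≤ C ∧ ∀ (g : Finset ι → (ι → α) → ℝ) (e : ℝ),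
      (∀ J, Measurable (g J)) →
      (∀ J, MemLp (g J) 2) → (∀ J, DependsOn (g J) (J : Set ι)) → 0 ≤ e →
      (∀ I K, I ⊂ K →
        |∫ x, g K x * coordAverage I (g K) x * f x| ≤ e * lpNorm (g K) 2 volume) →
      lpNorm (g K) 2 volume ≤ C * (lpNorm (∑ J, g J) 2 volume + e) := by
    intro K
    -- The induction descends from the full set: the bound for `K` uses those for its strict
    -- supersets.
    induction K using (wellFounded_gt (α := Finset ι)).induction with
    | _ K ih =>
    choose! D hD0 hD using ih
    set N : ℝ := (Fintype.card (Finset ι) : ℝ)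
    have hN : 0 ≤ N := Nat.cast_nonneg _
    have hS : 0 ≤ ∑ J with K ⊂ J, D J :=
      Finset.sum_nonneg fun J hJ => hD0 J (Finset.mem_filter.1 hJ).2
    refine ⟨N * (c₂ * (1 + ∑ J with K ⊂ J, D J) + 1) / c₁, by positivity,
      fun g e hg hg2 hgJ he horth => ?_⟩
    have h1 := lpNorm_le_of_hierarchically_orthogonal_aux hf hc₁ hc₂ hfc hg hg2 hgJ he horth K
    have h2 : ∑ J with K ⊂ J, lpNorm (g J) 2 volume
        ≤ (∑ J with K ⊂ J, D J) * (lpNorm (∑ J, g J) 2 volume + e) := by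
      rw [Finset.sum_mul]
      exact Finset.sum_le_sum fun J hJ =>
        hD J (Finset.mem_filter.1 hJ).2 g e hg hg2 hgJ he horth
    set n := lpNorm (∑ J, g J) 2 volume
    have hn : 0 ≤ n := lpNorm_nonneg
    rw [div_mul_eq_mul_div, le_div_iff₀ hc₁, mul_comm]
    refine h1.trans ?_
    rw [mul_assoc]
    refine mul_le_mul_of_nonneg_left ?_ hN
    have h3 := mul_le_mul_of_nonneg_left h2 hc₂.le
    have h4 : 0 ≤ c₂ * e := by positivity
    linarith
  choose C hC0 hC using key
  have hsum : 0 ≤ ∑ K, C K := Finset.sum_nonneg fun K _ => hC0 K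
  refine ⟨∑ K, C K + 1, by linarith, fun g e hg hg2 hgJ he horth K => ?_⟩
  refine (hC K g e hg hg2 hgJ he horth).trans ?_
  have hn : 0 ≤ lpNorm (∑ J, g J) 2 volume := lpNorm_nonneg
  gcongr
  exact (Finset.single_le_sum (f := C) (fun K _ => hC0 K) (Finset.mem_univ K)).trans (by linarith)

end Stability

/-! ### Functions with mean zero on the fibres of a map to a finite set. -/

section FiniteFibers

variable {Ω D : Type*} [MeasurableSpace Ω] {μ : Measure Ω} [MeasurableSpace D] [Finite D]
  [MeasurableSingletonClass D] {S : Ω → D} {u : Ω → ℝ}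

lemma integral_mul_comp_eq_zero_of_fibers (hS : Measurable S) (hu : Integrable u μ)
    (h : ∀ d, ∫ x in S ⁻¹' {d}, u x ∂μ = 0) (F : D → ℝ) :
    ∫ x, u x * F (S x) ∂μ = 0 := by
  have := Fintype.ofFinite D
  have hd : ∀ d, MeasurableSet (S ⁻¹' {d}) := fun d => hS (measurableSet_singleton d)
  have heq : ∀ d, Set.EqOn (fun x => u x * F (S x)) (fun x => u x * F d) (S ⁻¹' {d}) := by
    intro d x hx
    simp only [Set.mem_preimage, Set.mem_singleton_iff] at hx
    simp [hx]
  have huniv : (⋃ d, S ⁻¹' {d}) = Set.univ := by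
    ext x
    simp
  rw [← setIntegral_univ, ← huniv, integral_iUnion_fintype hd]
  · refine Finset.sum_eq_zero fun d _ => ?_
    rw [setIntegral_congr_fun (hd d) (heq d), integral_mul_const, h d, zero_mul]
  · intro a b hab
    exact Set.disjoint_left.2 fun x hx hx' => hab (hx.symm.trans hx')
  · intro d
    exact ((hu.mul_const (F d)).integrableOn).congr_fun (heq d).symm (hd d)

/-- Since the mean of `u` on a fibre vanishes, `u x` is the mean of `u x - u x'` over `x'` in the
fibre of `x`. Fibres of measure zero give no information, whence the "almost every". -/
lemma ae_abs_le_of_oscillation_le [IsFiniteMeasure μ] (hS : Measurable S) (hu : Integrable u μ)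
    (h : ∀ d, ∫ x in S ⁻¹' {d}, u x ∂μ = 0) {k : Ω → ℝ}
    (hk : ∀ x x', S x = S x' → |u x - u x'| ≤ k x) : ∀ᵐ x ∂μ, |u x| ≤ k x := by
  have : ∀ᵐ x ∂μ, ∀ d, S x = d → |u x| ≤ k x := by
    rw [ae_all_iff]
    intro d
    have hd : MeasurableSet (S ⁻¹' {d}) := hS (measurableSet_singleton d)
    by_cases h0 : μ (S ⁻¹' {d}) = 0
    · filter_upwards [measure_eq_zero_iff_ae_notMem.1 h0] with x hx hx'
      exact absurd hx' hx
    refine ae_of_all _ fun x hx => ?_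
    have hpos : 0 < μ.real (S ⁻¹' {d}) :=
      ENNReal.toReal_pos h0 (measure_ne_top _ _)
    have h1 : ∫ x' in S ⁻¹' {d}, (u x - u x') ∂μ = μ.real (S ⁻¹' {d}) * u x := by
      rw [integral_sub (integrable_const _) hu.integrableOn, h d, sub_zero, setIntegral_const,
        smul_eq_mul]
    have h2 : ‖∫ x' in S ⁻¹' {d}, (u x - u x') ∂μ‖ ≤ k x * μ.real (S ⁻¹' {d}) := by
      refine norm_setIntegral_le_of_norm_le_const (measure_lt_top _ _) fun x' hx' => ?_
      exact hk x x' (hx.trans hx'.symm)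
    rw [h1, Real.norm_eq_abs, abs_mul, abs_of_pos hpos, mul_comm] at h2
    exact le_of_mul_le_mul_right h2 hpos
  filter_upwards [this] with x hx
  exact hx _ rfl

end FiniteFibers

/-! ### Cells of the Cartesian tree partitions and cell-constant functions. -/

namespace RegTree

variable {p : ℕ} (t : RegTree p) {I K : Finset (Fin p)}

/-- The sides of the splits of the variables in `I` on which a point lies. -/
def cellCode (I : Finset (Fin p)) (x : Fin p → unitInterval) :
    (j : I) → t.splits j → Prop := fun j s => (x j : ℝ) ≤ s

lemma measurable_cellCode (I : Finset (Fin p)) : Measurable (t.cellCode I) := by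
  refine measurable_pi_lambda _ fun j => measurable_pi_lambda _ fun s => ?_
  rw [← measurableSet_setOfPred]
  exact measurableSet_le (by fun_prop) measurable_const

variable {t}

lemma cellCode_eq_iff {x x' : Fin p → unitInterval} :
    t.cellCode I x = t.cellCode I x'
      ↔ ∀ j ∈ I, ∀ s ∈ t.splits j, ((x j : ℝ) ≤ s ↔ (x' j : ℝ) ≤ s) := by
  simp [cellCode, funext_iff]

lemma dependsOn_cellCode : DependsOn (t.cellCode I) (I : Set (Fin p)) := by
  intro x x' h
  rw [cellCode_eq_iff]
  intro j hj s _
  rw [h j hj]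

/-- The product structure of the partition enters here: moving within an `I`-cell while the other
coordinates are frozen never changes the cell. -/
lemma cellCode_piecewise_congr {x x' : Fin p → unitInterval}
    (h : t.cellCode I x = t.cellCode I x') (y : Fin p → unitInterval) :
    t.cellCode K (I.piecewise x y) = t.cellCode K (I.piecewise x' y) := by
  rw [cellCode_eq_iff] at h ⊢
  intro j _ s hs
  by_cases hj : j ∈ I
  · simpa [hj] using h j hj s hs
  · simp [hj]

lemma exists_mem_cartesianPartition (x : Fin p → unitInterval) :
    ∃ A ∈ t.cartesianPartition I, ∀ x' : Fin p → unitInterval,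
      I.restrict x' ∈ A ↔ t.cellCode I x' = t.cellCode I x := by
  refine ⟨_, ⟨fun j : I => {v : unitInterval | ∀ s ∈ t.splits j,
    ((v : ℝ) ≤ s ↔ (x j : ℝ) ≤ s)}, fun j => ⟨x j, rfl⟩, rfl⟩, fun x' => ?_⟩
  simp [cellCode_eq_iff]

lemma abs_sub_le_cellVariability {M : ℕ} {T : Fin M → RegTree p}
    {f : (Fin p → unitInterval) → ℝ} {c₁ c₂ : ℝ} (hf : ∀ x, c₁ ≤ f x ∧ f x ≤ c₂) (l : Fin M)
    {x x' : Fin p → unitInterval}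
    (h : (T l).cellCode Finset.univ x = (T l).cellCode Finset.univ x') :
    |f x - f x'| ≤ cellVariability T f := by
  -- The bounds on `f` make the set of variations bounded above, so its supremum is genuine.
  refine le_csSup ⟨c₂ - c₁, ?_⟩ ?_
  · rintro d ⟨-, -, -, y, y', -, -, rfl⟩
    exact abs_le.2 ⟨by linarith [(hf y).1, (hf y').2], by linarith [(hf y').1, (hf y).2]⟩
  · obtain ⟨A, hA, hmem⟩ := exists_mem_cartesianPartition (t := T l) (I := Finset.univ) x'
    exact ⟨l, A, hA, x, x', (hmem x).2 h, (hmem x').2 rfl, rfl⟩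

/-- A function that is constant on the cells of the Cartesian partition on `K`. -/
def IsCellConstant (t : RegTree p) (K : Finset (Fin p)) (u : (Fin p → unitInterval) → ℝ) : Prop :=
  ∃ F : ((j : K) → t.splits j → Prop) → ℝ, ∀ x, u x = F (t.cellCode K x)

variable {u : (Fin p → unitInterval) → ℝ}

lemma isCellConstant_of_forall_eq
    (h : ∀ x x', t.cellCode K x = t.cellCode K x' → u x = u x') : t.IsCellConstant K u := by
  have : Function.FactorsThrough u (t.cellCode K) := fun x x' hx => h x x' hx
  exact ⟨Function.extend (t.cellCode K) u 0, fun x => (this.extend_apply _ x).symm⟩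

namespace IsCellConstant

lemma eq_of_cellCode_eq (hu : t.IsCellConstant K u) {x x' : Fin p → unitInterval}
    (h : t.cellCode K x = t.cellCode K x') : u x = u x' := by
  obtain ⟨F, hF⟩ := hu
  rw [hF, hF, h]

lemma dependsOn (hu : t.IsCellConstant K u) : DependsOn u (K : Set (Fin p)) :=
  fun _ _ h => hu.eq_of_cellCode_eq (dependsOn_cellCode h)

lemma measurable (hu : t.IsCellConstant K u) : Measurable u := by
  obtain ⟨F, hF⟩ := hu
  rw [funext hF]
  exact (measurable_of_finite F).comp (t.measurable_cellCode K)

lemma exists_bound (hu : t.IsCellConstant K u) : ∃ c, ∀ x, |u x| ≤ c := by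
  obtain ⟨F, hF⟩ := hu
  obtain ⟨c, hc⟩ := (Set.finite_range fun d => |F d|).bddAbove
  exact ⟨c, fun x => hF x ▸ hc ⟨_, rfl⟩⟩

lemma memLp (hu : t.IsCellConstant K u) {q : ENNReal} : MemLp u q := by
  obtain ⟨c, hc⟩ := hu.exists_bound
  exact MemLp.of_bound hu.measurable.aestronglyMeasurable c (ae_of_all _ hc)

lemma coordAverage (hu : t.IsCellConstant K u) (I : Finset (Fin p)) :
    t.IsCellConstant I (coordAverage I u) := by
  refine isCellConstant_of_forall_eq fun x x' h => ?_
  unfold _root_.coordAverage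
  congr 1
  ext y
  exact hu.eq_of_cellCode_eq (cellCode_piecewise_congr h y)

/-- If `u` is constant on cells and has mean zero on the cells of the coordinates in `I` for the
density `f`, then its covariance with a square-integrable function of the coordinates in `I` is
controlled by the oscillation of `f` on the cells. -/
lemma abs_integral_mul_mul_le (hu : t.IsCellConstant K u)
    {f : (Fin p → unitInterval) → ℝ} (hf : Measurable f) {c δ : ℝ} (hfc : ∀ x, |f x| ≤ c)
    (hδ : ∀ x x', t.cellCode Finset.univ x = t.cellCode Finset.univ x' → |f x - f x'| ≤ δ)
    (hmean : ∀ d, ∫ x in t.cellCode I ⁻¹' {d}, u x * f x = 0)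
    {v : (Fin p → unitInterval) → ℝ} (hv : MemLp v 2) (hvI : DependsOn v (I : Set (Fin p))) :
    |∫ x, u x * v x * f x| ≤ δ * (lpNorm u 2 volume * lpNorm v 2 volume) := by
  obtain ⟨b, hb⟩ := hu.exists_bound
  have hufm : Measurable fun x => u x * f x := hu.measurable.mul hf
  have huf : Integrable fun x => u x * f x :=
    (hu.memLp.integrable le_rfl).mul_bdd (c := c) hf.aestronglyMeasurable (ae_of_all _ hfc)
  have hufv : Integrable fun x => u x * f x * v x := by
    refine ((hv.integrable one_le_two).bdd_mul (c := b * c) hufm.aestronglyMeasurable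
      (ae_of_all _ fun x => ?_))
    rw [Real.norm_eq_abs, abs_mul]
    exact mul_le_mul (hb x) (hfc x) (abs_nonneg _) ((abs_nonneg _).trans (hb x))
  have huv : Integrable fun x => |u x| * |v x| := (hu.memLp (q := 2)).abs.integrable_mul hv.abs
  -- Only `ψ` matters when `u * f` is tested against functions of the coordinates in `I`. It has
  -- mean zero on the `I`-cells and small oscillation there, hence is itself small.
  set ψ := _root_.coordAverage I fun x => u x * f x with hψ
  have hψi : Integrable ψ := integrable_coordAverage huf I
  have hsec : ∀ x : Fin p → unitInterval, Measurable fun y => I.piecewise x y := fun x =>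
    (measurable_finset_piecewise I).comp (measurable_const.prodMk measurable_id)
  have hsecu : ∀ x, Integrable fun y => u (I.piecewise x y) := fun x =>
    Integrable.of_bound (hu.measurable.comp (hsec x)).aestronglyMeasurable b
      (ae_of_all _ fun y => hb _)
  have hsecuf : ∀ x, Integrable fun y => u (I.piecewise x y) * f (I.piecewise x y) := fun x =>
    (hsecu x).mul_bdd (c := c) (hf.comp (hsec x)).aestronglyMeasurable
      (ae_of_all _ fun y => hfc _)
  have hψmean : ∀ d, ∫ x in t.cellCode I ⁻¹' {d}, ψ x = 0 := by
    intro d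
    have hd : MeasurableSet (t.cellCode I ⁻¹' {d}) :=
      t.measurable_cellCode I (measurableSet_singleton d)
    have hind : ∀ w : (Fin p → unitInterval) → ℝ, ∫ x in t.cellCode I ⁻¹' {d}, w x
        = ∫ x, w x * (t.cellCode I ⁻¹' {d}).indicator 1 x := fun w => by
      rw [← integral_indicator hd]
      congr 1
      ext x
      by_cases hx : x ∈ t.cellCode I ⁻¹' {d} <;> simp [hx]
    rw [hind, hψ, ← integral_mul_coordAverage, ← hind, hmean]
    · intro x x' h
      simp only [Set.indicator, Set.mem_preimage, dependsOn_cellCode (t := t) h]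
      rfl
    · refine huf.mul_bdd (c := 1) (measurable_one.indicator hd).aestronglyMeasurable
        (ae_of_all _ fun x => ?_)
      by_cases hx : x ∈ t.cellCode I ⁻¹' {d} <;> simp [hx]
  have hosc : ∀ x x', t.cellCode I x = t.cellCode I x' →
      |ψ x - ψ x'| ≤ δ * _root_.coordAverage I (fun z => |u z|) x := by
    intro x x' h
    simp only [hψ, _root_.coordAverage]
    rw [← integral_sub (hsecuf x) (hsecuf x'), ← integral_const_mul, ← Real.norm_eq_abs]
    -- For each `y` both spliced points lie in one cell, so `u` factors out and only the variation
    -- of `f` remains.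
    refine norm_integral_le_of_norm_le ((hsecu x).abs.const_mul δ) (ae_of_all _ fun y => ?_)
    rw [← hu.eq_of_cellCode_eq (cellCode_piecewise_congr h y), ← mul_sub, Real.norm_eq_abs,
      abs_mul, mul_comm]
    gcongr
    exact hδ _ _ (cellCode_piecewise_congr h y)
  have hle := ae_abs_le_of_oscillation_le (t.measurable_cellCode I) hψi hψmean hosc
  have hvI' : DependsOn (fun x => |v x|) (I : Set (Fin p)) := fun x x' h => by
    simp only [hvI h]
  have hδ0 : 0 ≤ δ := (abs_nonneg _).trans (hδ 0 0 rfl)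
  calc |∫ x, u x * v x * f x| = |∫ x, ψ x * v x| := by
        rw [hψ, ← integral_mul_coordAverage hvI hufv]
        simp only [mul_right_comm]
    _ ≤ ∫ x, δ * (_root_.coordAverage I (fun z => |u z|) x * |v x|) := by
        rw [← Real.norm_eq_abs]
        refine norm_integral_le_of_norm_le (Integrable.const_mul ?_ δ) ?_
        · have hm := measurable_coordAverage (g := fun z => |u z|) hu.measurable.abs I
          refine (hv.integrable one_le_two).abs.bdd_mul (c := b) hm.aestronglyMeasurable
            (ae_of_all _ fun x => ?_)
          refine (norm_integral_le_of_norm_le_const (ae_of_all _ fun y => ?_)).trans_eq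
            (by rw [probReal_univ, mul_one])
          rw [Real.norm_eq_abs, abs_abs]
          exact hb _
        · filter_upwards [hle] with x hx
          rw [Real.norm_eq_abs, abs_mul, ← mul_assoc]
          gcongr
    _ = δ * ∫ x, |u x| * |v x| := by
        rw [integral_const_mul, ← integral_mul_coordAverage hvI' huv]
    _ ≤ _ := by
        gcongr
        exact integral_abs_mul_abs_le_lpNorm_mul_lpNorm hu.memLp hv

end IsCellConstant

end RegTree

/-! ### Transfer between the law of `X` and Lebesgue measure. -/

section CubeDensity

variable {Ω : Type*} [MeasurableSpace Ω] {P : Measure Ω} {p : ℕ}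
  {X : Ω → Fin p → unitInterval} {f : (Fin p → unitInterval) → ℝ} {c₁ c₂ : ℝ}

namespace HasCubeDensity

lemma integral_comp (hX : HasCubeDensity P X f) (hf : ∀ x, 0 ≤ f x)
    {u : (Fin p → unitInterval) → ℝ} (hu : Measurable u) :
    ∫ ω, u (X ω) ∂P = ∫ x, u x * f x := by
  rw [← integral_map hX.measurable_vector.aemeasurable hu.aestronglyMeasurable, hX.law_eq,
    integral_withDensity_eq_integral_toReal_smul hX.measurable_density.ennreal_ofReal
      (ae_of_all _ fun x => ENNReal.ofReal_lt_top)]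
  congr 1
  ext x
  rw [ENNReal.toReal_ofReal (hf x), smul_eq_mul, mul_comm]

lemma map_le (hX : HasCubeDensity P X f) (hf : ∀ x, f x ≤ c₂) :
    P.map X ≤ ENNReal.ofReal c₂ • (volume : Measure (Fin p → unitInterval)) := by
  rw [hX.law_eq, ← withDensity_const]
  exact withDensity_mono (ae_of_all _ fun x => ENNReal.ofReal_le_ofReal (hf x))

lemma volume_le (hX : HasCubeDensity P X f) (hc₁ : 0 < c₁) (hf : ∀ x, c₁ ≤ f x) :
    (volume : Measure (Fin p → unitInterval)) ≤ (ENNReal.ofReal c₁)⁻¹ • P.map X := by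
  have h : ENNReal.ofReal c₁ • (volume : Measure (Fin p → unitInterval)) ≤ P.map X := by
    rw [hX.law_eq, ← withDensity_const]
    exact withDensity_mono (ae_of_all _ fun x => ENNReal.ofReal_le_ofReal (hf x))
  calc (volume : Measure (Fin p → unitInterval))
      = (ENNReal.ofReal c₁)⁻¹ • (ENNReal.ofReal c₁ • volume) := by
        rw [smul_smul, ENNReal.inv_mul_cancel (by simpa using hc₁) ENNReal.ofReal_ne_top, one_smul]
    _ ≤ _ := by gcongr

lemma memLp_comp (hX : HasCubeDensity P X f) (hf : ∀ x, f x ≤ c₂)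
    {u : (Fin p → unitInterval) → ℝ} (hu : MemLp u 2) : MemLp (fun ω => u (X ω)) 2 P :=
  (hu.of_measure_le_smul ENNReal.ofReal_ne_top (hX.map_le hf)).comp_of_map
    hX.measurable_vector.aemeasurable

lemma memLp_of_comp (hX : HasCubeDensity P X f) (hc₁ : 0 < c₁) (hf : ∀ x, c₁ ≤ f x)
    {u : (Fin p → unitInterval) → ℝ} (hu : Measurable u) (hu2 : MemLp (fun ω => u (X ω)) 2 P) :
    MemLp u 2 := by
  refine MemLp.of_measure_le_smul (by simpa using hc₁) (hX.volume_le hc₁ hf) ?_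
  exact (memLp_map_measure_iff hu.aestronglyMeasurable hX.measurable_vector.aemeasurable).2 hu2

lemma mul_lpNorm_sq_le (hX : HasCubeDensity P X f) (hc₁ : 0 < c₁)
    (hf : ∀ x, c₁ ≤ f x ∧ f x ≤ c₂) {u : (Fin p → unitInterval) → ℝ} (hu : Measurable u)
    (hu2 : MemLp u 2) : c₁ * lpNorm u 2 volume ^ 2 ≤ ∫ ω, u (X ω) ^ 2 ∂P := by
  rw [hX.integral_comp (u := fun x => u x ^ 2) (fun x => hc₁.le.trans (hf x).1) (hu.pow_const 2),
    lpNorm_two_sq hu2.1, ← integral_const_mul]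
  refine integral_mono (hu2.integrable_sq.const_mul _) (hu2.integrable_sq.mul_bdd (c := c₂)
    hX.measurable_density.aestronglyMeasurable (ae_of_all _ fun x => ?_)) fun x => ?_
  · exact abs_le.2 ⟨by linarith [(hf x).1, (hf x).2], (hf x).2⟩
  · rw [mul_comm]
    exact mul_le_mul_of_nonneg_left (hf x).1 (sq_nonneg _)

lemma integral_sq_le (hX : HasCubeDensity P X f) (hc₁ : 0 < c₁)
    (hf : ∀ x, c₁ ≤ f x ∧ f x ≤ c₂) {u : (Fin p → unitInterval) → ℝ} (hu : Measurable u)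
    (hu2 : MemLp u 2) : ∫ ω, u (X ω) ^ 2 ∂P ≤ c₂ * lpNorm u 2 volume ^ 2 := by
  rw [hX.integral_comp (u := fun x => u x ^ 2) (fun x => hc₁.le.trans (hf x).1) (hu.pow_const 2),
    lpNorm_two_sq hu2.1, ← integral_const_mul]
  refine integral_mono (hu2.integrable_sq.mul_bdd (c := c₂)
    hX.measurable_density.aestronglyMeasurable (ae_of_all _ fun x => ?_))
    (hu2.integrable_sq.const_mul _) fun x => ?_
  · exact abs_le.2 ⟨by linarith [(hf x).1, (hf x).2], (hf x).2⟩
  · rw [mul_comm]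
    exact mul_le_mul_of_nonneg_right (hf x).2 (sq_nonneg _)

end HasCubeDensity

namespace IsTreeHoeffdingDecomposition

variable {t : RegTree p} {η : (J : Finset (Fin p)) → (J → unitInterval) → ℝ}

lemma isCellConstant (h : IsTreeHoeffdingDecomposition P X t η) (K : Finset (Fin p)) :
    t.IsCellConstant K fun x => η K (K.restrict x) := by
  refine RegTree.isCellConstant_of_forall_eq fun x x' hx => ?_
  obtain ⟨A, hA, hmem⟩ := RegTree.exists_mem_cartesianPartition (t := t) (I := K) x'
  obtain ⟨c, hc⟩ := h.piecewise_constant K A hA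
  rw [hc _ ((hmem x).2 hx), hc _ ((hmem x').2 rfl)]

lemma setIntegral_cell_eq_zero [IsProbabilityMeasure P]
    (h : IsTreeHoeffdingDecomposition P X t η)
    (hX : HasCubeDensity P X f) (hf : ∀ x, 0 ≤ f x) {I K : Finset (Fin p)} (hIK : I ⊂ K)
    (d : (j : I) → t.splits j → Prop) :
    ∫ x in t.cellCode I ⁻¹' {d}, η K (K.restrict x) * f x = 0 := by
  have hd : MeasurableSet (t.cellCode I ⁻¹' {d}) :=
    t.measurable_cellCode I (measurableSet_singleton d)
  have hXd : MeasurableSet (X ⁻¹' (t.cellCode I ⁻¹' {d})) := hX.measurable_vector hd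
  have hm := (h.isCellConstant K).measurable
  have hconv : ∫ x in t.cellCode I ⁻¹' {d}, η K (K.restrict x) * f x
      = ∫ ω in X ⁻¹' (t.cellCode I ⁻¹' {d}), η K (K.restrict (X ω)) ∂P := by
    rw [← integral_indicator hd, ← integral_indicator hXd]
    have := hX.integral_comp hf (hm.indicator hd)
    simp only [Set.indicator_mul_left]
    rw [← this]
    rfl
  rw [hconv]
  rcases (t.cellCode I ⁻¹' {d}).eq_empty_or_nonempty with he | ⟨x₀, hx₀⟩
  · simp [he]
  obtain ⟨A, hA, hmem⟩ := RegTree.exists_mem_cartesianPartition (t := t) (I := I) x₀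
  have hset : {ω | I.restrict (X ω) ∈ A} = X ⁻¹' (t.cellCode I ⁻¹' {d}) := by
    ext ω
    rw [Set.mem_ofPred_eq, hmem, show t.cellCode I x₀ = d from hx₀]
    rfl
  have h0 := h.cond_integral_eq_zero I K hIK A hA
  rw [hset, ProbabilityTheory.cond, integral_smul_measure, smul_eq_zero] at h0
  -- The normalising factor of the conditional measure vanishes as a real number only if the cell
  -- has probability 0 (its inverse is then infinite), and then the integral is trivially 0.
  rcases h0 with h0 | h0
  · rw [ENNReal.toReal_eq_zero_iff, ENNReal.inv_eq_zero, ENNReal.inv_eq_top] at h0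
    rcases h0 with h0 | h0
    · exact absurd h0 (measure_ne_top _ _)
    · rw [Measure.restrict_eq_zero.2 h0, integral_zero_measure]
  · exact h0

end IsTreeHoeffdingDecomposition

section Measurability

lemma exists_measurable_factor_of_dependsOn {v : (Fin p → unitInterval) → ℝ} (hv : Measurable v)
    {I : Finset (Fin p)} (hvI : DependsOn v (I : Set (Fin p))) :
    ∃ V : (I → unitInterval) → ℝ, Measurable V ∧ ∀ x, v x = V (I.restrict x) := by
  refine ⟨fun z => v fun i => if h : i ∈ I then z ⟨i, h⟩ else 0, hv.comp ?_, fun x => ?_⟩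
  · refine measurable_pi_lambda _ fun i => ?_
    by_cases h : i ∈ I
    · simp only [h, dite_true]
      fun_prop
    · simp only [h, dite_false]
      fun_prop
  · refine hvI fun i hi => ?_
    simp [Finset.mem_coe.1 hi]

end Measurability

/-- Versions of the components of a Hoeffding decomposition that are measurable functions on the
cube. -/
lemma IsHoeffdingDecomposition.exists_measurable_version [IsProbabilityMeasure P]
    {m : (Fin p → unitInterval) → ℝ} {mJ : (J : Finset (Fin p)) → (J → unitInterval) → ℝ}
    (h : IsHoeffdingDecomposition P X m mJ) (hX : HasCubeDensity P X f) (hc₁ : 0 < c₁)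
    (hf : ∀ x, c₁ ≤ f x ∧ f x ≤ c₂) :
    ∃ w : Finset (Fin p) → (Fin p → unitInterval) → ℝ,
      (∀ J, Measurable (w J)) ∧ (∀ J, MemLp (w J) 2) ∧
      (∀ J, DependsOn (w J) (J : Set (Fin p))) ∧
      (∀ J, ∀ᵐ ω ∂P, w J (X ω) = mJ J (J.restrict (X ω))) ∧
      ∀ I J : Finset (Fin p), I ⊂ J → ∀ v : (Fin p → unitInterval) → ℝ, Measurable v → MemLp v 2 →
        DependsOn v (I : Set (Fin p)) → ∫ x, w J x * v x * f x = 0 := by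
  have hr : ∀ J : Finset (Fin p), Measurable fun ω => J.restrict (X ω) := fun J =>
    (Finset.measurable_restrict J).comp hX.measurable_vector
  have hae : ∀ J : Finset (Fin p), ∀ᵐ ω ∂P,
      (h.memLp J).1.mk _ (J.restrict (X ω)) = mJ J (J.restrict (X ω)) := fun J =>
    ae_of_ae_map (hr J).aemeasurable (h.memLp J).1.ae_eq_mk.symm
  have hwm : ∀ J : Finset (Fin p), Measurable fun x : Fin p → unitInterval =>
      (h.memLp J).1.mk _ (J.restrict x) := fun J =>
    (h.memLp J).1.stronglyMeasurable_mk.measurable.comp (Finset.measurable_restrict J)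
  have hw2 : ∀ J : Finset (Fin p), MemLp (fun x : Fin p → unitInterval =>
      (h.memLp J).1.mk _ (J.restrict x)) 2 := fun J => by
    refine hX.memLp_of_comp hc₁ (fun x => (hf x).1) (hwm J) ?_
    exact (memLp_congr_ae (hae J)).2 ((h.memLp J).comp_of_map (hr J).aemeasurable)
  refine ⟨fun J x => (h.memLp J).1.mk _ (J.restrict x), hwm, hw2,
    fun J x x' hx => ?_, hae, fun I J hIJ v hv hv2 hvI => ?_⟩
  · exact congrArg _ (funext fun i => hx i i.2)
  · obtain ⟨V, hV, hvV⟩ := exists_measurable_factor_of_dependsOn hv hvI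
    rw [← hX.integral_comp (u := fun x => (h.memLp J).1.mk _ (J.restrict x) * v x)
      (fun x => hc₁.le.trans (hf x).1) ((hwm J).mul hv),
      ← integral_condExp (hr I).comap_le]
    have hvs : StronglyMeasurable[MeasurableSpace.comap (fun ω => I.restrict (X ω)) inferInstance]
        fun ω => v (X ω) := by
      simp only [hvV]
      exact (hV.comp (comap_measurable _)).stronglyMeasurable
    have hw2P := hX.memLp_comp (fun x => (hf x).2) (hw2 J)
    have hv2P := hX.memLp_comp (fun x => (hf x).2) hv2
    refine integral_eq_zero_of_ae ?_
    -- Conditionally on the coordinates in `I`, `v` is a constant factor and the component has mean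
    -- zero.
    filter_upwards [condExp_mul_of_stronglyMeasurable_right hvs (hw2P.integrable_mul hv2P)
      (hw2P.integrable one_le_two), (condExp_congr_ae (hae J)).trans
        (h.condExp_eq_zero I J hIJ)] with ω h1 h2
    refine h1.trans ?_
    rw [Pi.mul_apply, h2, Pi.zero_apply, zero_mul]

end CubeDensity

/-! ### Orthogonality for a single tree, and the final estimate. -/

lemma IsTreeHoeffdingDecomposition.integral_mul_coordAverage_eq_zero {Ω : Type*}
    [MeasurableSpace Ω] {P : Measure Ω} [IsProbabilityMeasure P] {p : ℕ}
    {X : Ω → Fin p → unitInterval} {f : (Fin p → unitInterval) → ℝ} {c₁ c₂ : ℝ} {t : RegTree p}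
    {η : (J : Finset (Fin p)) → (J → unitInterval) → ℝ}
    (h : IsTreeHoeffdingDecomposition P X t η) (hX : HasCubeDensity P X f) (hc₁ : 0 < c₁)
    (hf : ∀ x, c₁ ≤ f x ∧ f x ≤ c₂) {I K : Finset (Fin p)} (hIK : I ⊂ K) :
    ∫ x, η K (K.restrict x) * coordAverage I (fun z => η K (K.restrict z)) x * f x = 0 := by
  obtain ⟨F, hF⟩ := (h.isCellConstant K).coordAverage I
  have hi : Integrable fun x : Fin p → unitInterval => η K (K.restrict x) * f x :=
    ((h.isCellConstant K).memLp.integrable le_rfl).mul_bdd (c := c₂)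
      hX.measurable_density.aestronglyMeasurable
      (ae_of_all _ fun x => abs_le.2 ⟨by linarith [(hf x).1, (hf x).2], (hf x).2⟩)
  have := integral_mul_comp_eq_zero_of_fibers (t.measurable_cellCode I) hi
    (h.setIntegral_cell_eq_zero hX (fun x => hc₁.le.trans (hf x).1) hIK) F
  simp only [hF]
  rw [← this]
  congr 1
  ext x
  ring

theorem theorem6 {Ω : Type*} [MeasurableSpace Ω] (P : Measure Ω) [IsProbabilityMeasure P]
    (p : ℕ) (hp : 0 < p)
    -- the input vector and its density
    (X : Ω → Fin p → unitInterval) (f : (Fin p → unitInterval) → ℝ)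
    (hX : HasCubeDensity P X f)
    (c₁ c₂ : ℝ) (hc₁ : 0 < c₁) (hc₂ : 0 < c₂) (hf : ∀ x, c₁ ≤ f x ∧ f x ≤ c₂)
    -- the regression model
    (m : (Fin p → unitInterval) → ℝ) (hm : MemLp m 2 volume)
    (Y ε : Ω → ℝ) (hε : Measurable ε) (hind : IndepFun X ε P)
    (hY : ∀ᵐ ω ∂P, Y ω = m (X ω) + ε ω)
    -- the Hoeffding decomposition of the regression function
    (mJ : (J : Finset (Fin p)) → (J → unitInterval) → ℝ)
    (hmJ : IsHoeffdingDecomposition P X m mJ) :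
    ∃ K₁ K₂ : ℝ, 0 < K₁ ∧ 0 < K₂ ∧
      ∀ (M : ℕ), 0 < M → ∀ (T : Fin M → RegTree p)
        (η : Fin M → (J : Finset (Fin p)) → (J → unitInterval) → ℝ),
        (∀ l, IsTreeHoeffdingDecomposition P X (T l) (η l)) →
        ∀ J : Finset (Fin p),
          ∫ ω, ((∑ l, η l J (J.restrict (X ω))) - mJ J (J.restrict (X ω))) ^ 2 ∂P
            ≤ K₁ * ∫ ω, (m (X ω) - ensemblePredict T (X ω)) ^ 2 ∂P
              + K₂ * cellVariability T f ^ 2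
                * (∑ l, √(∫ ω, (T l).predict (X ω) ^ 2 ∂P)) ^ 2 := by
  have hf0 : ∀ x, 0 ≤ f x := fun x => hc₁.le.trans (hf x).1
  have hfabs : ∀ x, |f x| ≤ c₂ := fun x => abs_le.2 ⟨by linarith [hf0 x], (hf x).2⟩
  obtain ⟨C, hC, hstab⟩ :=
    exists_lpNorm_le_of_hierarchically_orthogonal hX.measurable_density hc₁ hc₂ hf
  obtain ⟨w, hwm, hw2, hwJ, hwae, hworth⟩ := hmJ.exists_measurable_version hX hc₁ hf
  -- Passing between `P` and Lebesgue measure costs `c₂` and `1 / c₁`, the 2 comes from squaring a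
  -- sum, and stability gives `C ^ 2`. The second constant has another `C ^ 2` because the tree
  -- components are bounded by stability too.
  refine ⟨2 * c₂ * C ^ 2 / c₁, 2 * c₂ * C ^ 4 / c₁, by positivity, by positivity,
    fun M _ T η hη J => ?_⟩
  set Δ := cellVariability T f with hΔ
  set u : Fin M → Finset (Fin p) → (Fin p → unitInterval) → ℝ :=
    fun l K x => η l K (K.restrict x) with hu
  have hcc : ∀ l K, (T l).IsCellConstant K (u l K) := fun l K => (hη l).isCellConstant K
  have hu2 : ∀ l K, MemLp (u l K) 2 := fun l K => (hcc l K).memLp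
  have htree : ∀ l K, √c₁ * lpNorm (u l K) 2 volume
      ≤ C * √(∫ ω, (T l).predict (X ω) ^ 2 ∂P) := by
    intro l K
    -- Error 0 is allowed, since stability only tests each component against its own averages.
    have h1 := hstab (u l) 0 (fun K => (hcc l K).measurable) (hu2 l)
      (fun K => (hcc l K).dependsOn) le_rfl
      (fun I K hIK => by
        rw [(hη l).integral_mul_coordAverage_eq_zero hX hc₁ hf hIK]
        simp) K
    have h2 := hX.mul_lpNorm_sq_le hc₁ hf
      (u := ∑ K, u l K) (by
        have := fun K => (hcc l K).measurable
        fun_prop)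
      (memLp_finsetSum' _ fun K _ => hu2 l K)
    have h3 : ∫ ω, (∑ K, u l K) (X ω) ^ 2 ∂P = ∫ ω, (T l).predict (X ω) ^ 2 ∂P := by
      refine integral_congr_ae ?_
      filter_upwards [(hη l).sum_eq] with ω hω
      rw [hω, Finset.sum_apply]
    rw [h3] at h2
    have h4 := Real.sqrt_le_sqrt h2
    rw [Real.sqrt_mul hc₁.le, Real.sqrt_sq lpNorm_nonneg] at h4
    rw [add_zero] at h1
    calc _ ≤ √c₁ * (C * lpNorm (∑ K, u l K) 2 volume) := by gcongr
      _ = C * (√c₁ * lpNorm (∑ K, u l K) 2 volume) := by ring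
      _ ≤ _ := by gcongr
  set S := ∑ l, √(∫ ω, (T l).predict (X ω) ^ 2 ∂P) with hS
  have hS0 : 0 ≤ S := Finset.sum_nonneg fun l _ => Real.sqrt_nonneg _
  have hΔ0 : 0 ≤ Δ := Real.sSup_nonneg fun d hd => by
    obtain ⟨-, -, -, x, x', -, -, rfl⟩ := hd
    exact abs_nonneg _
  have hsqrt : 0 < √c₁ := Real.sqrt_pos.2 hc₁
  -- By `htree`, `C * S / √c₁` bounds the sum over the trees of the norms of their components on any
  -- fixed `K`.
  set e := Δ * (C * S / √c₁) with he
  have he0 : 0 ≤ e := by positivity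
  set g : Finset (Fin p) → (Fin p → unitInterval) → ℝ := fun K => ∑ l, u l K - w K with hg
  have hum : ∀ l K, Measurable (u l K) := fun l K => (hcc l K).measurable
  have hgm : ∀ K, Measurable (g K) := fun K => by
    have := fun l => hum l K
    have := hwm K
    simp only [hg]
    fun_prop
  have hg2 : ∀ K, MemLp (g K) 2 := fun K =>
    (memLp_finsetSum' _ fun l _ => hu2 l K).sub (hw2 K)
  have hgK : ∀ K, DependsOn (g K) (K : Set (Fin p)) := fun K x x' hx => by
    simp only [hg, Pi.sub_apply, Finset.sum_apply, hwJ K hx, fun l => (hcc l K).dependsOn hx]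
  have horth : ∀ I K, I ⊂ K →
      |∫ x, g K x * coordAverage I (g K) x * f x| ≤ e * lpNorm (g K) 2 volume := by
    intro I K hIK
    set v := coordAverage I (g K) with hv
    have hvm : Measurable v := measurable_coordAverage (hgm K) I
    have hv2 : MemLp v 2 := memLp_coordAverage (hgm K) (hg2 K) I
    have hvI : DependsOn v (I : Set (Fin p)) := dependsOn_coordAverage I (g K)
    have hvn : lpNorm v 2 volume ≤ lpNorm (g K) 2 volume :=
      lpNorm_coordAverage_le (hgm K) (hg2 K) I
    have hint : ∀ z : (Fin p → unitInterval) → ℝ, MemLp z 2 →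
        Integrable fun x => z x * v x * f x := fun z hz =>
      (hz.integrable_mul hv2).mul_bdd (c := c₂) hX.measurable_density.aestronglyMeasurable
        (ae_of_all _ hfabs)
    -- The component of `m` drops out by exact orthogonality, so only the trees contribute to the
    -- error.
    have hsplit : ∫ x, g K x * v x * f x = ∑ l, ∫ x, u l K x * v x * f x := by
      rw [← integral_finsetSum _ fun l _ => hint _ (hu2 l K),
        ← sub_zero (∫ x, ∑ l, u l K x * v x * f x), ← hworth I K hIK v hvm hv2 hvI,
        ← integral_sub (integrable_finsetSum _ fun l _ => hint _ (hu2 l K)) (hint _ (hw2 K))]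
      congr 1
      ext x
      simp only [hg, Pi.sub_apply, Finset.sum_apply, sub_mul, Finset.sum_mul]
    have hl : ∀ l, |∫ x, u l K x * v x * f x| ≤ Δ * (lpNorm (u l K) 2 volume * lpNorm v 2 volume) :=
      fun l => (hcc l K).abs_integral_mul_mul_le hX.measurable_density hfabs
        (fun x x' h => RegTree.abs_sub_le_cellVariability hf l h)
        ((hη l).setIntegral_cell_eq_zero hX hf0 hIK) hv2 hvI
    rw [hsplit]
    calc _ ≤ ∑ l, Δ * (lpNorm (u l K) 2 volume * lpNorm v 2 volume) :=
          (Finset.abs_sum_le_sum_abs _ _).trans (Finset.sum_le_sum fun l _ => hl l)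
      _ = Δ * (∑ l, lpNorm (u l K) 2 volume) * lpNorm v 2 volume := by
          rw [← Finset.mul_sum, ← Finset.sum_mul, mul_assoc]
      _ ≤ Δ * (C * S / √c₁) * lpNorm (g K) 2 volume := by
          have : ∑ l, lpNorm (u l K) 2 volume ≤ C * S / √c₁ := by
            rw [le_div_iff₀ hsqrt, mul_comm, Finset.mul_sum, hS, Finset.mul_sum]
            exact Finset.sum_le_sum fun l _ => htree l K
          have h0 : 0 ≤ lpNorm v 2 volume := lpNorm_nonneg
          gcongr
  have hmain := hstab g e hgm hg2 hgK he0 horth J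
  have hleft : ∫ ω, ((∑ l, η l J (J.restrict (X ω))) - mJ J (J.restrict (X ω))) ^ 2 ∂P
      = ∫ ω, g J (X ω) ^ 2 ∂P := by
    refine integral_congr_ae ?_
    filter_upwards [hwae J] with ω hω
    simp only [hg, hu, Pi.sub_apply, Finset.sum_apply, hω]
  have hright : ∫ ω, (m (X ω) - ensemblePredict T (X ω)) ^ 2 ∂P
      = ∫ ω, (∑ K, g K) (X ω) ^ 2 ∂P := by
    refine integral_congr_ae ?_
    filter_upwards [hmJ.sum_eq, ae_all_iff.2 hwae, ae_all_iff.2 fun l => (hη l).sum_eq]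
      with ω h1 h2 h3
    simp only [ensemblePredict, h1, h3, hg, hu, Pi.sub_apply, Finset.sum_apply, h2,
      Finset.sum_sub_distrib]
    rw [Finset.sum_comm]
    ring
  have h1 := hX.integral_sq_le hc₁ hf (hgm J) (hg2 J)
  have h2 := hX.mul_lpNorm_sq_le hc₁ hf (u := ∑ K, g K) (by fun_prop)
    (memLp_finsetSum' _ fun K _ => hg2 K)
  rw [hleft, hright]
  set n := lpNorm (∑ K, g K) 2 volume
  set R := ∫ ω, (∑ K, g K) (X ω) ^ 2 ∂P
  have hn0 : 0 ≤ n := lpNorm_nonneg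
  have hR : n ^ 2 ≤ R / c₁ := by
    rw [le_div_iff₀ hc₁, mul_comm]
    exact h2
  have he2 : e ^ 2 = C ^ 2 / c₁ * Δ ^ 2 * S ^ 2 := by
    rw [he, mul_pow, div_pow, mul_pow, Real.sq_sqrt hc₁.le]
    ring
  calc _ ≤ c₂ * lpNorm (g J) 2 volume ^ 2 := h1
    _ ≤ c₂ * (C * (n + e)) ^ 2 := by
        have h0 : 0 ≤ lpNorm (g J) 2 volume := lpNorm_nonneg
        gcongr
    _ ≤ c₂ * (C ^ 2 * (2 * (n ^ 2 + e ^ 2))) := by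
        rw [mul_pow]
        gcongr
        exact add_sq_le
    _ ≤ c₂ * (C ^ 2 * (2 * (R / c₁ + e ^ 2))) := by gcongr
    _ = _ := by
        rw [he2]
        ring
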